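/- All function spaces are over the unit circle $\mathbb T$ with normalised Lebesgue measure. For $1\le r\le\infty$, $H^r\subseteq L^r$ is the Hardy space (functions whose Fourier coefficients of negative index vanish), $(L^r)^n$ and $(H^r)^n$ are the spaces of columns of length $n$ with entries in $L^r$ and $H^r$, $(\overline{H^r_0})^n=\{\overline f: f\in (H^r)^n,\ f(0)=0\}$, and $L^{(r,n\times n)}$ is the space of $n\times n$ matrices with entries in $L^r$. For $1<r<\infty$ let $P_{r+}:(L^r)^n\to(H^r)^n$ be the Riesz projection, that is, the bounded projection onto $(H^r)^n$ along $(\overline{H^r_0})^n$, and let $P_{r-}=I-P_{r+}$. Let $\Theta$ be an $n\times n$ matrix inner function: its entries lie in $H^\infty$ and $\Theta(z)$ is unitary for almost every $z\in\mathbb T$. Put $K_\Theta^r=\Theta(\overline{H^r_0})^n\cap (H^r)^n$ and $P_{\Theta,r}=P_{r+}\Theta P_{r-}\Theta^*$. Two bounded operators $T:X\to\tilde X$ and $S:Y\to\tilde Y$ between Banach spaces are called equivalent after extension if there are (possibly trivial) Banach spaces $X_0,Y_0$ and boundedly invertible linear operators $E:\tilde Y\oplus Y_0\to\tilde X\oplus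 X_0$ and $F:X\oplus X_0\to Y\oplus Y_0$ with $$\begin{pmatrix}T&0\\0&I_{X_0}\end{pmatrix}=E\begin{pmatrix}S&0\\0&I_{Y_0}\end{pmatrix}F.$$ **Theorem.** Let $p\in(2,\infty]$, let $q\in(1,2]$ be given by $\frac1q=\frac12+\frac1p$, and let $G\in L^{(p,n\times n)}$. Then $$T_{\mathcal G}:(H^2)^n\times(H^q)^n\to(H^2)^n\times(H^q)^n,\qquad T_{\mathcal G}\begin{pmatrix}f_1\\f_2\end{pmatrix}=\begin{pmatrix}P_{2+}(\Theta^*f_1)\\P_{q+}(Gf_1+\Theta f_2)\end{pmatrix},$$ the Toeplitz operator with block symbol $\mathcal G=\begin{pmatrix}\Theta^*&0\\G&\Theta\end{pmatrix}$, and the modified matrix-valued truncated Toeplitz operator $$\tilde A_G^\Theta:K_\Theta^2\to K_\Theta^q,\qquad \tilde A_G^\Theta f=P_{\Theta,q}(Gf),$$ are well-defined bounded operators, and $T_{\mathcal G}$ is equivalent after extension to $\tilde A_G^\Theta$. -/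

import Mathlib

open MeasureTheory AddCircle
open scoped ENNReal Matrix

noncomputable section

namespace MTTO

/-- The unit circle `𝕋`, parametrised by `t ↦ exp (i t)`, `t ∈ ℝ / 2πℤ`. -/
abbrev Torus : Type := AddCircle (2 * Real.pi)

instance : Fact (0 < 2 * Real.pi) := ⟨Real.two_pi_pos⟩

/-- Normalised Lebesgue measure on `𝕋`. -/
abbrev leb : Measure Torus := haarAddCircle

/-- The complex space `L^r` of the circle. -/
abbrev L (r : ℝ≥0∞) : Type := Lp ℂ r leb

/-- `(L^r)^n`: columns of length `n` of elements of `L^r`, with the norm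
`(∑ i, ‖f i‖_r ^ r) ^ (1 / r)` (the supremum of the `‖f i‖_∞` for `r = ∞`). -/
abbrev LVec (n : ℕ) (r : ℝ≥0∞) : Type := PiLp r (fun _ : Fin n => L r)

/-- `L^{(r, n × n)}`: matrices with entries in `L^r`. -/
abbrev LMat (n : ℕ) (r : ℝ≥0∞) : Type := Matrix (Fin n) (Fin n) (L r)

section Hardy

variable (r : ℝ≥0∞) [Fact (1 ≤ r)]

theorem integrable_L {r : ℝ≥0∞} [hr : Fact (1 ≤ r)] (f : L r) : Integrable f leb :=
  (Lp.memLp f).integrable hr.out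

theorem coeff_add {r : ℝ≥0∞} [Fact (1 ≤ r)] (f g : L r) (k : ℤ) :
    fourierCoeff (f + g : L r) k = fourierCoeff f k + fourierCoeff g k := by
  rw [fourierCoeff_congr_ae (Lp.coeFn_add f g),
    fourierCoeff.add (integrable_L f) (integrable_L g), Pi.add_apply]

theorem coeff_smul {r : ℝ≥0∞} (c : ℂ) (f : L r) (k : ℤ) :
    fourierCoeff (c • f : L r) k = c * fourierCoeff f k := by
  rw [fourierCoeff_congr_ae (Lp.coeFn_smul c f), fourierCoeff.const_smul, smul_eq_mul]

theorem coeff_zero (r : ℝ≥0∞) (k : ℤ) : fourierCoeff (0 : L r) k = 0 := by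
  simpa using coeff_smul (0 : ℂ) (0 : L r) k

theorem coeff_star {r : ℝ≥0∞} (f : L r) (k : ℤ) :
    fourierCoeff (star f : L r) k = star (fourierCoeff f (-k)) := by
  rw [fourierCoeff_congr_ae (Lp.coeFn_star f)]
  simp only [fourierCoeff, smul_eq_mul, neg_neg]
  change _ = (starRingEnd ℂ) _
  rw [← integral_conj]
  congr 1
  ext t
  rw [Pi.star_apply, map_mul, starRingEnd_apply (f t), fourier_neg]

/-- The Hardy space `H^r`, as the space of boundary values on `𝕋`: the functions in `L^r` whose
Fourier coefficients of negative index vanish. -/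
def hardy : Submodule ℂ (L r) where
  carrier := {f | ∀ k : ℤ, k < 0 → fourierCoeff f k = 0}
  add_mem' := by
    intro f g hf hg k hk
    rw [coeff_add, hf k hk, hg k hk, add_zero]
  zero_mem' := fun k _ => coeff_zero r k
  smul_mem' := by
    intro c f hf k hk
    rw [coeff_smul, hf k hk, mul_zero]

/-- The space of complex conjugates of the `f ∈ H^r` with `f(0) = 0`, where `f(0)` is the
Fourier coefficient of index `0`. -/
def conjHardyZero : Submodule ℂ (L r) where
  carrier := {f | star f ∈ hardy r ∧ fourierCoeff (star f : L r) 0 = 0}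
  add_mem' := by
    intro f g hf hg
    refine ⟨fun k hk => ?_, ?_⟩
    · have h1 := hf.1 k hk
      have h2 := hg.1 k hk
      rw [coeff_star] at h1 h2 ⊢
      rw [coeff_add, star_add, h1, h2, add_zero]
    · have h1 := hf.2
      have h2 := hg.2
      rw [coeff_star] at h1 h2 ⊢
      rw [coeff_add, star_add, h1, h2, add_zero]
  zero_mem' := by
    refine ⟨fun k _ => ?_, ?_⟩ <;> rw [coeff_star, coeff_zero, star_zero]
  smul_mem' := by
    intro c f hf
    refine ⟨fun k hk => ?_, ?_⟩
    · have h1 := hf.1 k hk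
      rw [coeff_star] at h1 ⊢
      rw [coeff_smul, star_mul, h1, zero_mul]
    · have h1 := hf.2
      rw [coeff_star] at h1 ⊢
      rw [coeff_smul, star_mul, h1, zero_mul]

/-- The conjugates of functions in `H^r` vanishing at `0` are the functions in `L^r` whose Fourier
coefficients of non-negative index vanish. -/
theorem mem_conjHardyZero_iff {r : ℝ≥0∞} [Fact (1 ≤ r)] (f : L r) :
    f ∈ conjHardyZero r ↔ ∀ k : ℤ, 0 ≤ k → fourierCoeff f k = 0 := by
  constructor
  · rintro ⟨h, h0⟩ k hk
    rcases hk.eq_or_lt with rfl | hk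
    · rw [coeff_star] at h0
      simpa using h0
    · have h1 := h (-k) (by omega)
      rw [coeff_star] at h1
      simpa using h1
  · intro h
    refine ⟨fun k hk => ?_, ?_⟩
    · rw [coeff_star, h (-k) (by omega), star_zero]
    · rw [coeff_star, h (-0) (by simp), star_zero]

variable (n : ℕ)

/-- `(H^r)^n`. -/
def hardyVec : Submodule ℂ (LVec n r) where
  carrier := {f | ∀ i, f i ∈ hardy r}
  add_mem' := fun hf hg i => (hardy r).add_mem (hf i) (hg i)
  zero_mem' := fun _ => (hardy r).zero_mem
  smul_mem' := fun c _ hf i => (hardy r).smul_mem c (hf i)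

/-- The space of conjugates of the `f ∈ (H^r)^n` with `f(0) = 0`. -/
def conjHardyZeroVec : Submodule ℂ (LVec n r) where
  carrier := {f | ∀ i, f i ∈ conjHardyZero r}
  add_mem' := fun hf hg i => (conjHardyZero r).add_mem (hf i) (hg i)
  zero_mem' := fun _ => (conjHardyZero r).zero_mem
  smul_mem' := fun c _ hf i => (conjHardyZero r).smul_mem c (hf i)

end Hardy

/-- Multiplication of columns in `(L^r)^n` by a matrix in `L^{(p, n × n)}`, where
`1 / p + 1 / r = 1 / s`: the product `M f` with entries `∑ j, M i j * f j` lies in `(L^s)^n`. -/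
def matMul {n : ℕ} {p r s : ℝ≥0∞} [ENNReal.HolderTriple p r s] [Fact (1 ≤ r)] [Fact (1 ≤ s)]
    (M : LMat n p) : LVec n r →ₗ[ℂ] LVec n s where
  toFun f := WithLp.toLp s fun i => ∑ j, (M i j • f j : L s)
  map_add' f g := by
    ext1 i
    simp only [PiLp.add_apply, Lp.add_smul, Finset.sum_add_distrib]
  map_smul' c f := by
    ext1 i
    simp only [PiLp.smul_apply, RingHom.id_apply, Finset.smul_sum, ← Lp.smul_comm]

/-- `Θ` is an `n × n` matrix inner function: its entries belong to `H^∞` and its values are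
unitary almost everywhere on `𝕋`. -/
structure IsInner {n : ℕ} (Θ : LMat n ∞) : Prop where
  mem_hardy : ∀ i j, Θ i j ∈ hardy ∞
  unitary : ∀ᵐ z ∂leb, (Matrix.of fun i j => Θ i j z) ∈ Matrix.unitaryGroup (Fin n) ℂ

/-- The model space `K_Θ^r`: the intersection of `(H^r)^n` with the image under `Θ` of the
conjugates of the functions in `(H^r)^n` that vanish at `0`. -/
def modelSpace {n : ℕ} (Θ : LMat n ∞) (r : ℝ≥0∞) [Fact (1 ≤ r)] : Submodule ℂ (LVec n r) :=
  (conjHardyZeroVec r n).map (matMul Θ : LVec n r →ₗ[ℂ] LVec n r) ⊓ hardyVec r n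

/-- `g = P_{r+} f`, the Riesz projection of `f ∈ (L^r)^n`: `g` is the component of `f` in
`(H^r)^n` with respect to the decomposition of `(L^r)^n` into the conjugates of functions in
`(H^r)^n` vanishing at `0` and the functions in `(H^r)^n`. Then `P_{r-} f = f - g`. -/
def IsRieszProj {n : ℕ} {r : ℝ≥0∞} [Fact (1 ≤ r)] (f g : LVec n r) : Prop :=
  g ∈ hardyVec r n ∧ f - g ∈ conjHardyZeroVec r n

/-- `g = P_{Θ,r} f`, where `P_{Θ,r} = P_{r+} Θ P_{r-} Θ^*`. In the definition `u = P_{r+} (Θ^* f)`,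
so that `Θ^* f - u = P_{r-} (Θ^* f)`. -/
def IsModelProj {n : ℕ} {r : ℝ≥0∞} [Fact (1 ≤ r)] (Θ : LMat n ∞) (f g : LVec n r) : Prop :=
  ∃ u : LVec n r, IsRieszProj (matMul Θᴴ f) u ∧ IsRieszProj (matMul Θ (matMul Θᴴ f - u)) g

section Operators

variable {n : ℕ} {p q : ℝ≥0∞} [Fact (1 ≤ q)] [ENNReal.HolderTriple p 2 q]

/-- `A` is the modified matrix-valued truncated Toeplitz operator `K_Θ^2 → K_Θ^q`,
`f ↦ P_{Θ,q} (G f)`. -/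
def IsModifiedMTTO (Θ : LMat n ∞) (G : LMat n p)
    (A : modelSpace Θ 2 →L[ℂ] modelSpace Θ q) : Prop :=
  ∀ f : modelSpace Θ 2, IsModelProj Θ (matMul G (f : LVec n 2)) (A f : LVec n q)

/-- `T` is the Toeplitz operator on `(H^2)^n × (H^q)^n` with block symbol `[Θ^*, 0; G, Θ]`:
`(f₁, f₂) ↦ (P_{2+} (Θ^* f₁), P_{q+} (G f₁ + Θ f₂))`. -/
def IsBlockToeplitz (Θ : LMat n ∞) (G : LMat n p)
    (T : (hardyVec 2 n × hardyVec q n) →L[ℂ] (hardyVec 2 n × hardyVec q n)) : Prop :=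
  ∀ (f₁ : hardyVec 2 n) (f₂ : hardyVec q n),
    IsRieszProj (matMul Θᴴ (f₁ : LVec n 2)) ((T (f₁, f₂)).1 : LVec n 2) ∧
    IsRieszProj (matMul G (f₁ : LVec n 2) + matMul Θ (f₂ : LVec n q))
      ((T (f₁, f₂)).2 : LVec n q)

end Operators

/-- Equivalence after extension of bounded operators `T : X → X'` and `S : Y → Y'`: there are
Banach spaces `X₀`, `Y₀` and invertible bounded operators `E : Y' ⊕ Y₀ → X' ⊕ X₀`,
`F : X ⊕ X₀ → Y ⊕ Y₀` with `T ⊕ I = E (S ⊕ I) F`. The maximum norm that Mathlib puts on a product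
is equivalent to the sum of the two norms. -/
def EquivAfterExt {X X' Y Y' : Type}
    [NormedAddCommGroup X] [NormedSpace ℂ X] [NormedAddCommGroup X'] [NormedSpace ℂ X']
    [NormedAddCommGroup Y] [NormedSpace ℂ Y] [NormedAddCommGroup Y'] [NormedSpace ℂ Y']
    (T : X →L[ℂ] X') (S : Y →L[ℂ] Y') : Prop :=
  ∃ (X₀ : Type) (_ : NormedAddCommGroup X₀) (_ : NormedSpace ℂ X₀) (_ : CompleteSpace X₀)
    (Y₀ : Type) (_ : NormedAddCommGroup Y₀) (_ : NormedSpace ℂ Y₀) (_ : CompleteSpace Y₀)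
    (E : (Y' × Y₀) ≃L[ℂ] (X' × X₀)) (F : (X × X₀) ≃L[ℂ] (Y × Y₀)),
    T.prodMap (ContinuousLinearMap.id ℂ X₀) =
      (E : (Y' × Y₀) →L[ℂ] (X' × X₀)) ∘L
        S.prodMap (ContinuousLinearMap.id ℂ Y₀) ∘L (F : (X × X₀) →L[ℂ] (Y × Y₀))

end MTTO

end

open Filter Topology Complex

namespace MTTO

/-! ### Fourier coefficients on `L^r` and uniqueness. -/

section Coefficients

variable {r : ℝ≥0∞} [Fact (1 ≤ r)]

/-! Since `Θ^*Θ = I`, multiplication by `Θ` on `(H^r)^n` has the left inverse `a = P_{r+}Θ^*`. The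
kernel of `a` is `K_Θ^r`, and `P_{Θ,r} = I - Θa` on `(H^r)^n`, so `(H^r)^n = K_Θ^r ⊕ Θ(H^r)^n`
(`exists_projections`). With `B f = P_{q+}(G f)` the block Toeplitz operator is `(f₁, f₂) ↦ (a f₁, B
f₁ + Θ f₂)`. Here `a` is invertible from the `Θ`-part of the first domain factor, and `Θ` onto the
`Θ`-part of the second target factor. With these two pivots all of `B` can be cleared except its
corner `K_Θ^2 → K_Θ^q`. That corner is the modified truncated operator, because `P_{Θ,q}` does not
distinguish `G f` from `P_{q+}(G f)` (`equivAfterExt_of_decomposition`).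

The analysis lies in the boundedness of `P_{r+}`, needed only for `1 < r ≤ 2` (`exists_rieszProj`).
If `F` is entire with positive real part on the circle and `F 0` is real, a pointwise bound of
`|F|^s` by `A (Re F)^s - B Re F^s` is integrated; the mean of `F^s` is `F(0)^s ≥ 0`, so `‖F‖_s ≤ C
‖Re F‖_s`. Since the projection of `Re F` is `(F + F 0)/2`, density gives the general bound. The
bounded projection also yields `H^∞ H^r ⊆ H^r`, by reduction to monomials. -/

theorem norm_fourierCoeff_le (f : L r) (k : ℤ) : ‖fourierCoeff f k‖ ≤ ‖f‖ := by
  have h1 : ‖fourierCoeff f k‖ ≤ ∫ t, ‖f t‖ ∂leb := by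
    refine (norm_integral_le_integral_norm _).trans_eq (integral_congr_ae (.of_forall fun t => ?_))
    simp only [norm_smul]
    rw [fourier_apply, Circle.norm_coe, one_mul]
  refine h1.trans ?_
  rw [integral_norm_eq_lintegral_enorm (Lp.aestronglyMeasurable f), ← eLpNorm_one_eq_lintegral_enorm,
    Lp.norm_def]
  exact ENNReal.toReal_mono (Lp.eLpNorm_ne_top f)
    (eLpNorm_le_eLpNorm_of_exponent_le Fact.out (Lp.aestronglyMeasurable f))

/-- The Fourier coefficient of index `k`, as a bounded functional on `L^r`. -/
noncomputable def coeffL (r : ℝ≥0∞) [Fact (1 ≤ r)] (k : ℤ) : L r →L[ℂ] ℂ :=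
  LinearMap.mkContinuous
    { toFun := fun f => fourierCoeff f k
      map_add' := fun f g => coeff_add f g k
      map_smul' := fun c f => coeff_smul c f k } 1
    fun f => by simpa using norm_fourierCoeff_le f k

theorem coeffL_apply (k : ℤ) (f : L r) : coeffL r k f = fourierCoeff f k := rfl

theorem fourierCoeff_toLp_eq (f : C(Torus, ℂ)) (k : ℤ) :
    fourierCoeff (ContinuousMap.toLp (E := ℂ) r leb ℂ f) k = fourierCoeff f k := by
  rw [fourierCoeff_congr_ae (ContinuousMap.coeFn_toLp leb f)]

theorem fourierCoeff_fourierLp (j k : ℤ) :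
    fourierCoeff (fourierLp (T := 2 * Real.pi) r j) k = if k = j then 1 else 0 := by
  rw [fourierCoeff_toLp_eq, fourierCoeff_fourier, Pi.single_apply]

/-- Continuous linear maps on `L^r` that agree on the monomials are equal. -/
theorem eqOn_of_fourierLp (hr : r ≠ ∞) {E : Type*} [NormedAddCommGroup E] [NormedSpace ℂ E]
    {A B : L r →L[ℂ] E} (h : ∀ j : ℤ, A (fourierLp r j) = B (fourierLp r j)) : A = B := by
  apply ContinuousLinearMap.ext_on (s := Set.range (fourierLp (T := 2 * Real.pi) r))
  · rw [← Submodule.dense_iff_topologicalClosure_eq_top.symm]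
    exact span_fourierLp_closure_eq_top hr
  · rintro _ ⟨j, rfl⟩
    exact h j

/-- An integrable function on the circle all of whose Fourier coefficients vanish is zero. -/
theorem ae_eq_zero_of_fourierCoeff_eq_zero {f : Torus → ℂ} (hf : Integrable f leb)
    (h : ∀ k : ℤ, fourierCoeff f k = 0) : f =ᵐ[leb] 0 := by
  -- Pairing with `f` is a bounded functional on continuous functions that kills the monomials,
  -- whose span is dense.
  have hcont : ∀ g : C(Torus, ℂ), ∫ t, g t * f t ∂leb = 0 := by
    have hint : ∀ g : C(Torus, ℂ), Integrable (fun t => g t * f t) leb := fun g =>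
      hf.bdd_mul g.continuous.aestronglyMeasurable (.of_forall fun t => g.norm_coe_le_norm t)
    let Φ : C(Torus, ℂ) →L[ℂ] ℂ := LinearMap.mkContinuous
      { toFun := fun g => ∫ t, g t * f t ∂leb
        map_add' := fun g g' => by
          simp only [ContinuousMap.add_apply, add_mul]
          exact integral_add (hint g) (hint g')
        map_smul' := fun c g => by
          simp only [ContinuousMap.smul_apply, smul_eq_mul, mul_assoc, RingHom.id_apply]
          exact integral_const_mul c _ } (∫ t, ‖f t‖ ∂leb) (fun g => by
        change ‖∫ t, g t * f t ∂leb‖ ≤ _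
        refine (norm_integral_le_integral_norm _).trans ?_
        rw [mul_comm (∫ t, ‖f t‖ ∂leb), ← integral_const_mul]
        refine integral_mono (hint g).norm (hf.norm.const_mul _) fun t => ?_
        rw [norm_mul]
        gcongr
        exact g.norm_coe_le_norm t)
    have hΦ : Φ = 0 := by
      apply ContinuousLinearMap.ext_on (s := Set.range (fourier (T := 2 * Real.pi)))
      · rw [← Submodule.dense_iff_topologicalClosure_eq_top.symm]
        exact span_fourier_closure_eq_top
      · rintro _ ⟨j, rfl⟩
        have := h (-j)
        rw [fourierCoeff, neg_neg] at this
        exact this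
    intro g
    exact DFunLike.congr_fun hΦ g
  refine ae_eq_zero_of_forall_setIntegral_isClosed_eq_zero hf fun s hs => ?_
  rw [← integral_indicator hs.measurableSet]
  -- The indicator of a closed set is a pointwise limit of continuous functions with values in `[0,
  -- 1]`, so `|f|` dominates.
  have hlim : Tendsto (fun m => ∫ t, ((hs.apprSeq m t : ℝ) : ℂ) * f t ∂leb) atTop
      (𝓝 (∫ t, s.indicator f t ∂leb)) := by
    refine tendsto_integral_of_dominated_convergence (fun t => ‖f t‖) (fun m => ?_) hf.norm
      (fun m => .of_forall fun t => ?_) (.of_forall fun t => ?_)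
    · exact Continuous.aestronglyMeasurable (by fun_prop) |>.mul hf.aestronglyMeasurable
    · rw [norm_mul, Complex.norm_real, Real.norm_of_nonneg (NNReal.coe_nonneg _)]
      exact mul_le_of_le_one_left (norm_nonneg _)
        (by exact_mod_cast HasOuterApproxClosed.apprSeq_apply_le_one hs m t)
    · have h1 := (tendsto_pi_nhds.1 (HasOuterApproxClosed.tendsto_apprSeq hs)) t
      have h2 : Tendsto (fun m => ((hs.apprSeq m t : ℝ) : ℂ)) atTop
          (𝓝 (((s.indicator (fun _ => (1 : NNReal)) t : NNReal) : ℝ) : ℂ)) :=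
        (Complex.continuous_ofReal.tendsto _).comp ((NNReal.continuous_coe.tendsto _).comp h1)
      convert h2.mul_const (f t) using 2
      by_cases ht : t ∈ s <;> simp [ht]
  refine tendsto_nhds_unique hlim ?_
  have : ∀ m, ∫ t, ((hs.apprSeq m t : ℝ) : ℂ) * f t ∂leb = 0 := fun m =>
    hcont ⟨fun t => ((hs.apprSeq m t : ℝ) : ℂ), by fun_prop⟩
  simp only [this, tendsto_const_nhds]

theorem eq_zero_of_coeff_eq_zero {f : L r} (h : ∀ k : ℤ, fourierCoeff f k = 0) : f = 0 :=
  (Lp.eq_zero_iff_ae_eq_zero).2 (ae_eq_zero_of_fourierCoeff_eq_zero (integrable_L f) h)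

theorem eq_zero_of_mem_hardy_of_mem_conjHardyZero {f : L r} (h : f ∈ hardy r)
    (h' : f ∈ conjHardyZero r) : f = 0 :=
  eq_zero_of_coeff_eq_zero fun k => (lt_or_ge k 0).elim (h k)
    ((mem_conjHardyZero_iff f).1 h' k)

theorem isClosed_hardy (r : ℝ≥0∞) [Fact (1 ≤ r)] : IsClosed (hardy r : Set (L r)) := by
  have : (hardy r : Set (L r)) = ⋂ (k : ℤ) (_ : k < 0), {f | coeffL r k f = 0} := by
    ext f
    simp only [Set.mem_iInter]
    rfl
  rw [this]
  exact isClosed_iInter fun k => isClosed_iInter fun _ =>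
    isClosed_eq (coeffL r k).continuous continuous_const

end Coefficients

/-! ### Means of analytic functions over the circle. -/

section MeanValue

/-- The mean value property on the circle. -/
theorem integral_toCircle {H : ℂ → ℂ} (hH : DiffContOnCl ℂ H (Metric.ball 0 1)) :
    ∫ t : Torus, H (toCircle t : Circle) ∂leb = H 0 := by
  rw [← DiffContOnCl.circleAverage (f := H) (R := 1) (c := 0) (by simpa using hH),
    Real.circleAverage, AddCircle.integral_haarAddCircle,
    ← AddCircle.intervalIntegral_preimage (2 * Real.pi) 0, zero_add]
  congr 1
  refine intervalIntegral.integral_congr fun t _ => ?_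
  simp [circleMap, toCircle_apply_mk, Circle.coe_exp]

/-- The coefficient of index `-k` is the mean of `z ^ k * H z`, hence its value at `0`. -/
theorem fourierCoeff_toCircle {H : ℂ → ℂ} (hH : Differentiable ℂ H) (k : ℕ) :
    fourierCoeff (fun t : Torus => H (toCircle t : Circle)) (-k) = 0 ^ k * H 0 := by
  have : Differentiable ℂ fun z => z ^ k * H z := by fun_prop
  rw [← integral_toCircle (this.diffContOnCl)]
  refine integral_congr_ae (.of_forall fun t => ?_)
  simp [fourier_apply, toCircle_nsmul]

end MeanValue

/-! ### The inequality of M. Riesz for functions with positive real part. -/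

section RieszInequality

/-- The pointwise inequality behind the theorem of M. Riesz for exponents in `(1, 2]`. -/
theorem exists_norm_rpow_le {s : ℝ} (h1 : 1 < s) (h2 : s ≤ 2) :
    ∃ A B : ℝ, 0 ≤ A ∧ 0 ≤ B ∧ ∀ w : ℂ, 0 < w.re →
      ‖w‖ ^ s ≤ A * w.re ^ s - B * (w ^ (s : ℂ)).re := by
  have hpi := Real.pi_pos
  -- Any angle with `γ < π/2 < sγ` would do; the midpoint of `π/(2s)` and `π/2` is one. Then `cos γ
  -- > 0 > cos (sγ)`, where `sγ < π` because `s ≤ 2`.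
  set γ : ℝ := (Real.pi / (2 * s) + Real.pi / 2) / 2 with hγ
  have hs : Real.pi / (2 * s) < Real.pi / 2 := by
    apply div_lt_div_of_pos_left hpi <;> linarith
  have hs0 : 0 < Real.pi / (2 * s) := by positivity
  have hγ1 : γ < Real.pi / 2 := by linarith
  have hγ0 : 0 < γ := by linarith
  have hsγ : Real.pi / 2 < γ * s := by
    have : Real.pi / (2 * s) * s = Real.pi / 2 := by field_simp
    nlinarith
  have hcos : 0 < Real.cos γ := Real.cos_pos_of_mem_Ioo ⟨by linarith, hγ1⟩
  have hcos' : Real.cos (γ * s) < 0 := by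
    apply Real.cos_neg_of_pi_div_two_lt_of_lt hsγ
    nlinarith
  set B : ℝ := 1 / (-Real.cos (γ * s))
  have hB : 0 < B := by have := neg_pos.2 hcos'; positivity
  set A : ℝ := (1 + B) / Real.cos γ ^ s
  have hA : 0 < A := by positivity
  refine ⟨A, B, hA.le, hB.le, fun w hw => ?_⟩
  have hre : w.re = ‖w‖ * Real.cos (arg w) := (norm_mul_cos_arg w).symm
  have harg : |arg w| < Real.pi / 2 := abs_arg_lt_pi_div_two_iff.2 (.inl hw)
  have hcw : 0 < Real.cos (arg w) :=
    Real.cos_pos_of_mem_Ioo ⟨by linarith [abs_lt.1 harg], (abs_lt.1 harg).2⟩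
  -- If `|arg w| ≥ γ`, then `-B cos (s arg w) ≥ 1` by the choice of `B`. If `|arg w| ≤ γ`, the first
  -- term is at least `1 + B` by the choice of `A`, and the second costs at most `B`.
  have key : 1 ≤ A * Real.cos (arg w) ^ s - B * Real.cos (arg w * s) := by
    rw [← Real.cos_abs (arg w), ← Real.cos_abs (arg w * s), abs_mul, abs_of_pos (by linarith : 0 < s)]
    rw [← Real.cos_abs] at hcw
    rcases le_total γ |arg w| with h | h
    · have : Real.cos (|arg w| * s) ≤ Real.cos (γ * s) := by
        apply Real.cos_le_cos_of_nonneg_of_le_pi (by positivity) (by nlinarith)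
        gcongr
      have hB1 : B * Real.cos (γ * s) = -1 := by
        rw [one_div_mul_eq_div, div_neg, div_self hcos'.ne]
      have := mul_le_mul_of_nonneg_left this hB.le
      have : 0 ≤ A * Real.cos |arg w| ^ s := by positivity
      linarith
    · have hc : Real.cos γ ≤ Real.cos |arg w| :=
        Real.cos_le_cos_of_nonneg_of_le_pi (abs_nonneg _) (by linarith) h
      have : A * Real.cos γ ^ s ≤ A * Real.cos |arg w| ^ s := by gcongr
      have hA1 : A * Real.cos γ ^ s = 1 + B := by
        simp only [A]; field_simp
      have := mul_le_mul_of_nonneg_left (Real.cos_le_one (|arg w| * s)) hB.le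
      linarith
  rw [cpow_ofReal_re, hre, Real.mul_rpow (norm_nonneg _) hcw.le]
  calc ‖w‖ ^ s = ‖w‖ ^ s * 1 := (mul_one _).symm
    _ ≤ ‖w‖ ^ s * (A * Real.cos (arg w) ^ s - B * Real.cos (arg w * s)) := by gcongr
    _ = _ := by ring

/-- The maximum modulus principle for `exp (-F)`, whose modulus is `exp (-Re F)`, bounds `Re F`
below by its minimum on the circle. -/
theorem re_pos_of_re_pos_on_circle {F : ℂ → ℂ} (hF : Differentiable ℂ F)
    (hpos : ∀ t : Torus, 0 < (F (toCircle t : Circle)).re) {z : ℂ}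
    (hz : z ∈ Metric.closedBall (0 : ℂ) 1) : 0 < (F z).re := by
  have hpos' : ∀ z ∈ Metric.sphere (0 : ℂ) 1, 0 < (F z).re := fun z hz => by
    obtain ⟨t, ht⟩ := (homeomorphCircle Real.two_pi_pos.ne').surjective (⟨z, hz⟩ : Circle)
    have hz' : ((toCircle t : Circle) : ℂ) = z := by
      rw [← homeomorphCircle_apply Real.two_pi_pos.ne', ht]
    exact hz' ▸ hpos t
  obtain ⟨z₀, hz₀, hmin⟩ := (isCompact_sphere (0 : ℂ) 1).exists_isMinOn
    (NormedSpace.sphere_nonempty.2 zero_le_one)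
    (Complex.continuous_re.comp hF.continuous).continuousOn
  have := norm_le_of_forall_mem_frontier_norm_le (f := fun z => Complex.exp (-F z))
    (C := Real.exp (-(F z₀).re)) Metric.isBounded_ball
    (Differentiable.diffContOnCl (by fun_prop)) (fun w hw => by
      rw [frontier_ball _ one_ne_zero] at hw
      rw [Complex.norm_exp, neg_re, Real.exp_le_exp, neg_le_neg_iff]
      exact hmin hw) (z := z) (by rwa [closure_ball _ one_ne_zero])
  rw [Complex.norm_exp, neg_re, Real.exp_le_exp, neg_le_neg_iff] at this
  exact (hpos' z₀ hz₀).trans_le this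

/-- The restriction of an entire function to the circle. -/
noncomputable def onCircle {F : ℂ → ℂ} (hF : Differentiable ℂ F) : C(Torus, ℂ) :=
  ⟨fun t => F (toCircle t : Circle), by
    have := hF.continuous
    have := continuous_toCircle (T := 2 * Real.pi)
    fun_prop⟩

theorem onCircle_apply {F : ℂ → ℂ} (hF : Differentiable ℂ F) (t : Torus) :
    onCircle hF t = F (toCircle t : Circle) := rfl

/-- A real continuous function on the circle, regarded as a complex one. -/
noncomputable def toComplex (u : C(Torus, ℝ)) : C(Torus, ℂ) :=
  ContinuousMap.comp ⟨((↑) : ℝ → ℂ), Complex.continuous_ofReal⟩ u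

theorem toComplex_apply (u : C(Torus, ℝ)) (t : Torus) : toComplex u t = (u t : ℂ) := rfl

theorem continuous_toComplex : Continuous toComplex := ContinuousMap.continuous_postcomp _

/-- The real part of a continuous function on the circle. -/
noncomputable def reC (f : C(Torus, ℂ)) : C(Torus, ℝ) := ContinuousMap.comp ⟨re, Complex.continuous_re⟩ f

theorem reC_apply (f : C(Torus, ℂ)) (t : Torus) : reC f t = (f t).re := rfl

theorem continuous_reC : Continuous reC := ContinuousMap.continuous_postcomp _

/-- Positivity of `Re F` makes the principal branch of `F^s` analytic on the disc. Its mean `F(0)^s`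
is non-negative because `F 0` is a positive real, so the term with `B` can be dropped after
integration. -/
theorem integral_norm_rpow_le {s : ℝ} (h1 : 1 < s) (h2 : s ≤ 2) :
    ∃ A : ℝ, 0 ≤ A ∧ ∀ (F : ℂ → ℂ) (hF : Differentiable ℂ F), (F 0).im = 0 →
      (∀ t, 0 < reC (onCircle hF) t) →
      ∫ t, ‖onCircle hF t‖ ^ s ∂leb ≤ A * ∫ t, ‖toComplex (reC (onCircle hF)) t‖ ^ s ∂leb := by
  obtain ⟨A, B, hA, hB, hAB⟩ := exists_norm_rpow_le h1 h2
  refine ⟨A, hA, fun F hF h0 hpos => ?_⟩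
  have hpos' : ∀ z ∈ Metric.closedBall (0 : ℂ) 1, 0 < (F z).re := fun z hz =>
    re_pos_of_re_pos_on_circle hF hpos hz
  have hH : DiffContOnCl ℂ (fun z => F z ^ (s : ℂ)) (Metric.ball 0 1) := by
    refine DifferentiableOn.diffContOnCl_ball (U := Metric.closedBall 0 1) (fun z hz => ?_) le_rfl
    exact ((hF z).cpow_const (.inl (hpos' z hz))).differentiableWithinAt
  have hcont : Continuous fun t : Torus => onCircle hF t ^ (s : ℂ) :=
    (onCircle hF).continuous.cpow continuous_const (fun t => .inl (hpos t))
  have hint : ∀ g : Torus → ℝ, Continuous g → Integrable g leb := fun g hg =>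
    hg.integrable_of_hasCompactSupport (HasCompactSupport.of_compactSpace g)
  have hintC : Integrable (fun t : Torus => onCircle hF t ^ (s : ℂ)) leb :=
    hcont.integrable_of_hasCompactSupport (HasCompactSupport.of_compactSpace _)
  have hs : 0 ≤ s := by linarith
  have hi1 : Integrable (fun t => ‖onCircle hF t‖ ^ s) leb :=
    hint _ ((onCircle hF).continuous.norm.rpow_const fun _ => .inr hs)
  have hi2 : Integrable (fun t => ‖toComplex (reC (onCircle hF)) t‖ ^ s) leb :=
    hint _ ((toComplex (reC (onCircle hF))).continuous.norm.rpow_const fun _ => .inr hs)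
  have hi3 : Integrable (fun t => (onCircle hF t ^ (s : ℂ)).re) leb :=
    hint _ (Complex.continuous_re.comp hcont)
  have hmean : 0 ≤ ∫ t, (onCircle hF t ^ (s : ℂ)).re ∂leb := by
    have h3 : ∫ t, (onCircle hF t ^ (s : ℂ)).re ∂leb
        = (∫ t, onCircle hF t ^ (s : ℂ) ∂leb).re := by
      have := integral_re (𝕜 := ℂ) hintC
      simpa using this
    rw [h3]
    have h4 : ∫ t, onCircle hF t ^ (s : ℂ) ∂leb = F 0 ^ (s : ℂ) := integral_toCircle hH
    rw [h4]
    have h5 : F 0 = ((F 0).re : ℂ) := Complex.ext (by simp) (by simp [h0])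
    rw [h5, ← Complex.ofReal_cpow (hpos' 0 (by simp)).le, Complex.ofReal_re]
    exact Real.rpow_nonneg (hpos' 0 (by simp)).le _
  calc ∫ t, ‖onCircle hF t‖ ^ s ∂leb
      ≤ ∫ t, (A * ‖toComplex (reC (onCircle hF)) t‖ ^ s
          - B * (onCircle hF t ^ (s : ℂ)).re) ∂leb := by
        refine integral_mono hi1 ((hi2.const_mul A).sub (hi3.const_mul B)) fun t => ?_
        simp only [toComplex_apply, Complex.norm_real, Real.norm_of_nonneg (hpos t).le]
        exact hAB _ (hpos t)
    _ = A * ∫ t, ‖toComplex (reC (onCircle hF)) t‖ ^ s ∂leb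
          - B * ∫ t, (onCircle hF t ^ (s : ℂ)).re ∂leb := by
        rw [integral_sub (hi2.const_mul A) (hi3.const_mul B), integral_const_mul,
          integral_const_mul]
    _ ≤ _ := sub_le_self _ (mul_nonneg hB hmean)

/-- The class in `L^r` of a continuous function on the circle. -/
noncomputable abbrev toL (r : ℝ≥0∞) [Fact (1 ≤ r)] : C(Torus, ℂ) →L[ℂ] L r :=
  ContinuousMap.toLp (E := ℂ) r leb ℂ

theorem norm_toL {q : ℝ≥0∞} [Fact (1 ≤ q)] (hq : q ≠ ∞) (f : C(Torus, ℂ)) :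
    ‖toL q f‖ = (∫ t, ‖f t‖ ^ q.toReal ∂leb) ^ q.toReal⁻¹ := by
  have hq0 : q ≠ 0 := (zero_lt_one.trans_le (Fact.out : 1 ≤ q)).ne'
  rw [Lp.norm_def, eLpNorm_congr_ae (ContinuousMap.coeFn_toLp leb f),
    MemLp.eLpNorm_eq_integral_rpow_norm hq0 hq (ContinuousMap.memLp leb ℂ f), ENNReal.toReal_ofReal (by positivity)]

theorem norm_onCircle_le {q : ℝ≥0∞} [Fact (1 ≤ q)] (h1 : 1 < q) (h2 : q ≤ 2) :
    ∃ C : ℝ, 0 ≤ C ∧ ∀ (F : ℂ → ℂ) (hF : Differentiable ℂ F), (F 0).im = 0 →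
      (∀ t, 0 < reC (onCircle hF) t) →
      ‖toL q (onCircle hF)‖ ≤ C * ‖toL q (toComplex (reC (onCircle hF)))‖ := by
  have hq : q ≠ ∞ := (h2.trans_lt ENNReal.ofNat_lt_top).ne
  obtain ⟨A, hA, h⟩ := integral_norm_rpow_le (s := q.toReal)
    (by simpa using (ENNReal.toReal_lt_toReal ENNReal.one_ne_top hq).2 h1)
    (by simpa using ENNReal.toReal_mono ENNReal.ofNat_ne_top h2)
  refine ⟨A ^ q.toReal⁻¹, by positivity, fun F hF h0 hpos => ?_⟩
  rw [norm_toL hq, norm_toL hq, ← Real.mul_rpow hA (by positivity)]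
  exact Real.rpow_le_rpow (by positivity) (h F hF h0 hpos) (by positivity)

end RieszInequality

/-! ### The Riesz projection for exponents in `(1, 2]`. -/

section RieszProjection

instance (r : ℝ≥0∞) [Fact (1 ≤ r)] : CompleteSpace (hardy r) := (isClosed_hardy r).completeSpace_coe

theorem fourierLp_mem_hardy {r : ℝ≥0∞} [Fact (1 ≤ r)] {j : ℤ} (hj : 0 ≤ j) :
    (fourierLp r j : L r) ∈ hardy r := fun k hk => by
  rw [fourierCoeff_fourierLp, if_neg (by omega)]

theorem fourierLp_mem_conjHardyZero {r : ℝ≥0∞} [Fact (1 ≤ r)] {j : ℤ} (hj : j < 0) :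
    (fourierLp r j : L r) ∈ conjHardyZero r :=
  (mem_conjHardyZero_iff _).2 fun k hk => by rw [fourierCoeff_fourierLp, if_neg (by omega)]

/-- For exponent `2` the Riesz projection is the orthogonal one: the remainder is orthogonal to the
monomials of non-negative index. -/
theorem sub_starProjection_mem (f : L 2) : f - (hardy 2).starProjection f ∈ conjHardyZero 2 := by
  refine (mem_conjHardyZero_iff _).2 fun k hk => ?_
  have h := (hardy 2).sub_starProjection_mem_orthogonal f
  rw [← fourierBasis_repr, HilbertBasis.repr_apply_apply, coe_fourierBasis]
  exact (Submodule.mem_orthogonal _ _).1 h _ (fourierLp_mem_hardy hk)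

/-- The decomposition of an element of `L^r` along `H^r` and its complement is unique. -/
theorem eq_of_mem_hardy {r : ℝ≥0∞} [Fact (1 ≤ r)] {f x y : L r} (hx : x ∈ hardy r)
    (hx' : f - x ∈ conjHardyZero r) (hy : y ∈ hardy r) (hy' : f - y ∈ conjHardyZero r) : x = y := by
  refine sub_eq_zero.1 (eq_zero_of_mem_hardy_of_mem_conjHardyZero (sub_mem hx hy) ?_)
  convert sub_mem hy' hx' using 1
  abel

/-- The inclusion of `L^2` in `L^q`, `q ≤ 2`. -/
noncomputable def inclL {q : ℝ≥0∞} [Fact (1 ≤ q)] (hq : q ≤ 2) : L 2 →L[ℂ] L q :=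
  LinearMap.mkContinuous
    { toFun := fun f => ((Lp.memLp f).mono_exponent hq).toLp f
      map_add' := fun f g => by
        rw [← MemLp.toLp_add]
        exact MemLp.toLp_congr _ _ (Lp.coeFn_add f g)
      map_smul' := fun c f => by
        rw [RingHom.id_apply, ← MemLp.toLp_const_smul]
        exact MemLp.toLp_congr _ _ (Lp.coeFn_smul c f) } 1
    fun f => by
      rw [LinearMap.coe_mk, AddHom.coe_mk, Lp.norm_toLp, one_mul, Lp.norm_def]
      exact ENNReal.toReal_mono (Lp.eLpNorm_ne_top f)
        (eLpNorm_le_eLpNorm_of_exponent_le hq (Lp.aestronglyMeasurable f))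

theorem coeFn_inclL {q : ℝ≥0∞} [Fact (1 ≤ q)] (hq : q ≤ 2) (f : L 2) : inclL hq f =ᵐ[leb] f :=
  MemLp.coeFn_toLp ((Lp.memLp f).mono_exponent hq)

theorem fourierCoeff_inclL {q : ℝ≥0∞} [Fact (1 ≤ q)] (hq : q ≤ 2) (f : L 2) :
    fourierCoeff (inclL hq f) = fourierCoeff f := fourierCoeff_congr_ae (coeFn_inclL hq f)

theorem inclL_toL {q : ℝ≥0∞} [Fact (1 ≤ q)] (hq : q ≤ 2) (f : C(Torus, ℂ)) :
    inclL hq (toL 2 f) = toL q f :=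
  Lp.ext ((coeFn_inclL hq _).trans ((ContinuousMap.coeFn_toLp leb f).trans
    (ContinuousMap.coeFn_toLp leb f).symm))

theorem onCircle_mem_hardy {r : ℝ≥0∞} [Fact (1 ≤ r)] {F : ℂ → ℂ} (hF : Differentiable ℂ F) :
    toL r (onCircle hF) ∈ hardy r := fun k hk => by
  obtain ⟨m, rfl⟩ : ∃ m : ℕ, k = -m := ⟨k.natAbs, by omega⟩
  rw [fourierCoeff_toLp_eq]
  refine (fourierCoeff_toCircle hF m).trans ?_
  rw [zero_pow (by omega), zero_mul]

theorem fourierCoeff_onCircle_zero {F : ℂ → ℂ} (hF : Differentiable ℂ F) :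
    fourierCoeff (onCircle hF) 0 = F 0 := by
  have h := fourierCoeff_toCircle hF 0
  rw [Nat.cast_zero, neg_zero, pow_zero, one_mul] at h
  exact h

theorem norm_apply_zero_le {r : ℝ≥0∞} [Fact (1 ≤ r)] {F : ℂ → ℂ} (hF : Differentiable ℂ F) :
    ‖F 0‖ ≤ ‖toL r (onCircle hF)‖ := by
  have h : fourierCoeff (toL r (onCircle hF)) 0 = F 0 := by
    rw [fourierCoeff_toLp_eq, fourierCoeff_onCircle_zero]
  exact h ▸ norm_fourierCoeff_le _ 0

/-- The orthogonal projection onto `H^2` of the real part of an entire function `F` with `F 0`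
real is `(F + F 0) / 2`. -/
theorem starProjection_reC {F : ℂ → ℂ} (hF : Differentiable ℂ F) (h0 : (F 0).im = 0) :
    (hardy 2).starProjection (toL 2 (toComplex (reC (onCircle hF)))) =
      toL 2 ((1 / 2 : ℂ) • (onCircle hF + ContinuousMap.const _ (F 0))) := by
  have hg : Differentiable ℂ fun z => (1 / 2 : ℂ) * (F z + F 0) := by fun_prop
  have hd : Differentiable ℂ fun z => (1 / 2 : ℂ) * (F z - F 0) := by fun_prop
  have hgc : (1 / 2 : ℂ) • (onCircle hF + ContinuousMap.const _ (F 0)) = onCircle hg := by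
    ext t
    simp [onCircle_apply, mul_add]
  have hconj : (starRingEnd ℂ) (F 0) = F 0 := Complex.conj_eq_iff_im.2 h0
  -- As `F 0` is real, `Re F - (F + F 0)/2` is the conjugate of `(F - F 0)/2`, which vanishes at
  -- `0`.
  have hstar : star (toL 2 (toComplex (reC (onCircle hF))) - toL 2 (onCircle hg) : L 2) =
      toL 2 (onCircle hd) := by
    rw [← map_sub]
    refine Lp.ext ((Lp.coeFn_star _).trans ?_)
    filter_upwards [ContinuousMap.coeFn_toLp (p := 2) (𝕜 := ℂ) leb
        (toComplex (reC (onCircle hF)) - onCircle hg),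
      ContinuousMap.coeFn_toLp (p := 2) (𝕜 := ℂ) leb (onCircle hd)] with t h1 h2
    rw [Pi.star_apply, h1, h2, ContinuousMap.sub_apply, toComplex_apply, reC_apply,
      onCircle_apply, onCircle_apply, onCircle_apply, Complex.re_eq_add_conj, ← starRingEnd_apply]
    simp only [map_sub, map_mul, map_add, map_div₀, map_one, map_ofNat, Complex.conj_conj, hconj]
    ring
  rw [hgc]
  refine eq_of_mem_hardy (Submodule.starProjection_apply_mem _ _) (sub_starProjection_mem _)
    (onCircle_mem_hardy hg) ⟨?_, ?_⟩
  · rw [hstar]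
    exact onCircle_mem_hardy hd
  · rw [hstar, fourierCoeff_toLp_eq, fourierCoeff_onCircle_zero, sub_self, mul_zero]

theorem exists_entire_of_mem_span {f : C(Torus, ℂ)}
    (hf : f ∈ Submodule.span ℂ (Set.range (fourier (T := 2 * Real.pi)))) :
    ∃ A B : ℂ → ℂ, Differentiable ℂ A ∧ Differentiable ℂ B ∧
      ∀ t : Torus, f t = A (toCircle t : Circle) + (starRingEnd ℂ) (B (toCircle t : Circle)) := by
  induction hf using Submodule.span_induction with
  | mem f hf =>
    obtain ⟨k, rfl⟩ := hf
    obtain ⟨m, rfl | rfl⟩ := k.eq_nat_or_neg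
    · exact ⟨fun z => z ^ m, 0, by fun_prop, differentiable_const 0, fun t => by
        simp [fourier_apply, toCircle_nsmul]⟩
    · exact ⟨0, fun z => z ^ m, differentiable_const 0, by fun_prop, fun t => by
        rw [fourier_neg]; simp [fourier_apply, toCircle_nsmul]⟩
  | zero => exact ⟨0, 0, differentiable_const 0, differentiable_const 0, fun t => by simp⟩
  | add f g _ _ hf hg =>
    obtain ⟨A, B, hA, hB, h⟩ := hf
    obtain ⟨A', B', hA', hB', h'⟩ := hg
    exact ⟨A + A', B + B', hA.add hA', hB.add hB', fun t => by
      simp only [ContinuousMap.add_apply, h, h', Pi.add_apply, map_add]; ring⟩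
  | smul c f _ hf =>
    obtain ⟨A, B, hA, hB, h⟩ := hf
    exact ⟨fun z => c * A z, fun z => (starRingEnd ℂ) c * B z, by fun_prop, by fun_prop, fun t => by
      simp only [ContinuousMap.smul_apply, h, smul_eq_mul, map_mul, Complex.conj_conj]; ring⟩

/-- A trigonometric polynomial is `A + conj B` on the circle, with real part `Re (A + B)`;
subtracting an imaginary constant makes the value at `0` real without changing the real part. -/
theorem dense_reC_onCircle :
    Dense {u : C(Torus, ℝ) | ∃ (F : ℂ → ℂ) (hF : Differentiable ℂ F), (F 0).im = 0 ∧
      reC (onCircle hF) = u} := by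
  have hsurj : Function.Surjective reC := fun u => ⟨toComplex u, by
    ext t; simp [reC_apply, toComplex_apply]⟩
  refine (hsurj.denseRange.dense_image continuous_reC
    (Submodule.dense_iff_topologicalClosure_eq_top.2
      (span_fourier_closure_eq_top (T := 2 * Real.pi)))).mono ?_
  rintro _ ⟨f, hf, rfl⟩
  obtain ⟨A, B, hA, hB, h⟩ := exists_entire_of_mem_span hf
  refine ⟨fun z => A z + B z - I * ((A 0 + B 0).im : ℂ), by fun_prop, by simp, ?_⟩
  ext t
  simp [reC_apply, onCircle_apply, h]

theorem norm_toL_mono {q : ℝ≥0∞} [Fact (1 ≤ q)] {f g : C(Torus, ℂ)}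
    (h : ∀ t, ‖f t‖ ≤ ‖g t‖) : ‖toL q f‖ ≤ ‖toL q g‖ := by
  refine Lp.norm_le_norm_of_ae_le ?_
  filter_upwards [ContinuousMap.coeFn_toLp (p := q) (𝕜 := ℂ) leb f,
    ContinuousMap.coeFn_toLp (p := q) (𝕜 := ℂ) leb g] with t h1 h2
  rw [h1, h2]
  exact h t

/-- The inequality of M. Riesz for continuous functions and exponents in `(1, 2]`. -/
theorem exists_norm_starProjection_le {q : ℝ≥0∞} [Fact (1 ≤ q)] (h1 : 1 < q) (h2 : q ≤ 2) :
    ∃ C : ℝ, ∀ f : C(Torus, ℂ),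
      ‖inclL h2 ((hardy 2).starProjection (toL 2 f))‖ ≤ C * ‖toL q f‖ := by
  have hq : q ≠ ∞ := (h2.trans_lt ENNReal.ofNat_lt_top).ne
  obtain ⟨C, hC, hF⟩ := norm_onCircle_le h1 h2
  let R : C(Torus, ℂ) →L[ℂ] L q := inclL h2 ∘L (hardy 2).starProjection ∘L toL 2
  have hpos : ∀ u : C(Torus, ℝ), (∀ t, 0 < u t) →
      ‖R (toComplex u)‖ ≤ C * ‖toL q (toComplex u)‖ := by
    have hopen : IsOpen {u : C(Torus, ℝ) | ∀ t, 0 < u t} := by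
      have := ContinuousMap.isOpen_setOfPred_mapsTo (X := Torus) (Y := ℝ) isCompact_univ
        (isOpen_Ioi (a := (0 : ℝ)))
      convert this using 3
      simp [Set.MapsTo]
    have hclosed : IsClosed {u : C(Torus, ℝ) | ‖R (toComplex u)‖ ≤ C * ‖toL q (toComplex u)‖} := by
      have := continuous_toComplex
      exact isClosed_le (by fun_prop) (by fun_prop)
    intro u hu
    -- Strict positivity is an open condition, so a positive `u` is a limit of positive real parts
    -- of entire functions.
    refine hclosed.closure_subset_iff.2 ?_ (dense_reC_onCircle.open_subset_closure_inter hopen hu)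
    rintro _ ⟨hv, F, hF', h0, rfl⟩
    have hR : R (toComplex (reC (onCircle hF'))) =
        (1 / 2 : ℂ) • (toL q (onCircle hF') + toL q (ContinuousMap.const _ (F 0))) := by
      rw [← map_add, ← map_smul, ← inclL_toL h2, ← starProjection_reC hF' h0]
      rfl
    have hc : ‖toL q (ContinuousMap.const _ (F 0))‖ = ‖F 0‖ := by
      rw [norm_toL hq]
      have : q.toReal ≠ 0 := (ENNReal.toReal_pos (by positivity) hq).ne'
      simp [Real.rpow_rpow_inv (norm_nonneg _) this]
    change ‖R _‖ ≤ _
    rw [hR, norm_smul]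
    refine le_trans ?_ (hF F hF' h0 hv)
    have h3 := norm_add_le (toL q (onCircle hF')) (toL q (ContinuousMap.const _ (F 0)))
    have h4 := norm_apply_zero_le (r := q) hF'
    rw [hc] at h3
    norm_num
    linarith
  have hnonneg : ∀ u : C(Torus, ℝ), (∀ t, 0 ≤ u t) →
      ‖R (toComplex u)‖ ≤ C * ‖toL q (toComplex u)‖ := by
    intro u hu
    have hcont := continuous_toComplex
    have hlim : Tendsto (fun ε : ℝ => u + ContinuousMap.const _ ε) (𝓝[>] 0) (𝓝 u) := by
      have : Continuous fun ε : ℝ => u + ContinuousMap.const Torus ε :=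
        continuous_const.add ContinuousMap.continuous_const'
      have h := (this.tendsto 0).mono_left (nhdsWithin_le_nhds (s := Set.Ioi 0))
      convert h using 2
      ext; simp
    have hl : Continuous fun u : C(Torus, ℝ) => ‖R (toComplex u)‖ := by fun_prop
    have hr : Continuous fun u : C(Torus, ℝ) => C * ‖toL q (toComplex u)‖ := by fun_prop
    refine le_of_tendsto_of_tendsto ((hl.tendsto u).comp hlim) ((hr.tendsto u).comp hlim) ?_
    filter_upwards [self_mem_nhdsWithin] with ε hε
    exact hpos _ fun t => add_pos_of_nonneg_of_pos (hu t) hε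
  -- One `C` for each of the positive and negative parts of `Re f` and of `Im f = Re (-i f)`.
  refine ⟨4 * C, fun f => ?_⟩
  change ‖R f‖ ≤ _
  let u₁ : C(Torus, ℝ) := reC f ⊔ 0
  let u₂ : C(Torus, ℝ) := -reC f ⊔ 0
  let u₃ : C(Torus, ℝ) := reC (-I • f) ⊔ 0
  let u₄ : C(Torus, ℝ) := -reC (-I • f) ⊔ 0
  have hf : f = toComplex u₁ - toComplex u₂ + I • (toComplex u₃ - toComplex u₄) := by
    have hmax : ∀ x : ℝ, ((x ⊔ 0 : ℝ) : ℂ) - ((-x ⊔ 0 : ℝ) : ℂ) = x := fun x => by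
      rw [← Complex.ofReal_sub, max_zero_sub_max_neg_zero_eq_self]
    ext t
    have h1 := hmax (f t).re
    have h2 := hmax (f t).im
    simp only [ContinuousMap.add_apply, ContinuousMap.sub_apply, ContinuousMap.smul_apply,
      toComplex_apply, u₁, u₂, u₃, u₄, ContinuousMap.sup_apply, ContinuousMap.neg_apply, reC_apply,
      ContinuousMap.zero_apply, smul_eq_mul, neg_mul, neg_re, I_mul_re, neg_neg]
    rw [h1, h2, mul_comm I, re_add_im]
  have key : ∀ u : C(Torus, ℝ), (∀ t, 0 ≤ u t) → (∀ t, u t ≤ ‖f t‖) →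
      ‖R (toComplex u)‖ ≤ C * ‖toL q f‖ := fun u h0 hu =>
    (hnonneg u h0).trans (mul_le_mul_of_nonneg_left (norm_toL_mono fun t => by
      rw [toComplex_apply, Complex.norm_real, Real.norm_of_nonneg (h0 t)]
      exact hu t) hC)
  have b₁ := key u₁ (fun t => le_sup_right) fun t => sup_le (re_le_norm _) (norm_nonneg _)
  have b₂ := key u₂ (fun t => le_sup_right) fun t => sup_le
    ((neg_le_abs _).trans (abs_re_le_norm _)) (norm_nonneg _)
  have hI : ∀ t, |(reC (-I • f)) t| ≤ ‖f t‖ := fun t => by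
    refine (abs_re_le_norm _).trans_eq ?_
    simp
  have b₃ := key u₃ (fun t => le_sup_right) fun t => sup_le
    ((le_abs_self _).trans (hI t)) (norm_nonneg _)
  have b₄ := key u₄ (fun t => le_sup_right) fun t => sup_le
    ((neg_le_abs _).trans (hI t)) (norm_nonneg _)
  have hR : R f = R (toComplex u₁) - R (toComplex u₂) +
      I • (R (toComplex u₃) - R (toComplex u₄)) := by
    rw [← map_sub, ← map_sub, ← map_smul, ← map_add, ← hf]
  rw [hR]
  calc _ ≤ ‖R (toComplex u₁) - R (toComplex u₂)‖ +
        ‖I • (R (toComplex u₃) - R (toComplex u₄))‖ := norm_add_le _ _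
    _ ≤ (‖R (toComplex u₁)‖ + ‖R (toComplex u₂)‖) +
        (‖R (toComplex u₃)‖ + ‖R (toComplex u₄)‖) := by
      rw [norm_smul, norm_I, one_mul]
      exact add_le_add (norm_sub_le _ _) (norm_sub_le _ _)
    _ ≤ _ := by linarith

/-- The theorem of M. Riesz for exponents in `(1, 2]`: the projection of `L^q` onto `H^q` along its
complement is bounded. -/
theorem exists_rieszProj {q : ℝ≥0∞} [Fact (1 ≤ q)] (h1 : 1 < q) (h2 : q ≤ 2) :
    ∃ P : L q →L[ℂ] L q, ∀ f, P f ∈ hardy q ∧ f - P f ∈ conjHardyZero q := by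
  have hq : q ≠ ∞ := (h2.trans_lt ENNReal.ofNat_lt_top).ne
  obtain ⟨C, hC⟩ := exists_norm_starProjection_le h1 h2
  let R : C(Torus, ℂ) →L[ℂ] L q := inclL h2 ∘L (hardy 2).starProjection ∘L toL 2
  let P : L q →L[ℂ] L q := (R : C(Torus, ℂ) →ₗ[ℂ] L q).extendOfNorm (toL q : C(Torus, ℂ) →ₗ[ℂ] L q)
  have hP : ∀ f, P (toL q f) = inclL h2 ((hardy 2).starProjection (toL 2 f)) := fun f =>
    LinearMap.extendOfNorm_eq (f := (R : C(Torus, ℂ) →ₗ[ℂ] L q))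
      (e := (toL q : C(Torus, ℂ) →ₗ[ℂ] L q)) (ContinuousMap.toLp_denseRange ℂ leb ℂ hq) ⟨C, hC⟩ f
  refine ⟨P, fun f => ⟨fun k hk => ?_, (mem_conjHardyZero_iff _).2 fun k hk => ?_⟩⟩
  -- Membership is a condition on each coefficient, and these are continuous, so monomials suffice.
  · have : coeffL q k ∘L P = 0 := eqOn_of_fourierLp hq fun j => by
      rw [ContinuousLinearMap.comp_apply, coeffL_apply, hP, fourierCoeff_inclL]
      exact Submodule.starProjection_apply_mem (hardy 2) _ k hk
    exact DFunLike.congr_fun this f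
  · have : coeffL q k ∘L (ContinuousLinearMap.id ℂ _ - P) = 0 := eqOn_of_fourierLp hq fun j => by
      have := (mem_conjHardyZero_iff _).1 (sub_starProjection_mem (toL 2 (fourier j))) k hk
      rw [← coeffL_apply, map_sub, coeffL_apply, coeffL_apply, fourierCoeff_toLp_eq] at this
      rw [ContinuousLinearMap.comp_apply, sub_apply, map_sub, coeffL_apply,
        coeffL_apply, hP, fourierCoeff_inclL, ContinuousLinearMap.id_apply, fourierCoeff_toLp_eq,
        this, zero_apply]
    exact DFunLike.congr_fun this f

end RieszProjection

/-! ### Products with `H^∞` functions. -/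

section Multiplication

/-- Multiplication by an element of `L^p`, as a bounded operator `L^r → L^s`. -/
noncomputable def mulL {p r s : ℝ≥0∞} [ENNReal.HolderTriple p r s] [Fact (1 ≤ r)] [Fact (1 ≤ s)]
    (m : L p) : L r →L[ℂ] L s :=
  LinearMap.mkContinuous
    { toFun := fun f => m • f
      map_add' := fun f g => Lp.add_smul (r := s) m f g
      map_smul' := fun c f => (Lp.smul_comm (r := s) c m f).symm } ‖m‖
    fun f => Lp.norm_smul_le (r := s) m f

theorem star_lpSMul {r : ℝ≥0∞} (m : L ∞) (f : L r) : star (star m • f : L r) = m • star f := by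
  refine Lp.ext ?_
  filter_upwards [Lp.coeFn_star (star m • f : L r), Lp.coeFn_lpSMul (r := r) (star m) f,
    Lp.coeFn_star m, Lp.coeFn_lpSMul (r := r) m (star f), Lp.coeFn_star f] with t h1 h2 h3 h4 h5
  rw [h1, h4, Pi.star_apply, h2, Pi.smul_apply', Pi.smul_apply', h3, h5]
  simp [mul_comm]

variable {r : ℝ≥0∞} [Fact (1 ≤ r)]

theorem fourierCoeff_smul_fourierLp (m : L ∞) (j k : ℤ) :
    fourierCoeff (m • (fourierLp r j : L r) : L r) k = fourierCoeff m (k - j) := by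
  refine integral_congr_ae ?_
  filter_upwards [Lp.coeFn_lpSMul (r := r) m (fourierLp r j : L r), coeFn_fourierLp r j] with t h1 h2
  rw [h1, Pi.smul_apply', h2, neg_sub, sub_eq_neg_add, fourier_add]
  simp only [smul_eq_mul]
  ring

/-- Fourier coefficients of non-positive index of the product of functions in `H^∞` and `H^r`. -/
theorem fourierCoeff_smul_of_mem_hardy (h1 : 1 < r) (h2 : r ≤ 2) {m : L ∞} (hm : m ∈ hardy ∞)
    {f : L r} (hf : f ∈ hardy r) {k : ℤ} (hk : k ≤ 0) :
    fourierCoeff (m • f : L r) k = fourierCoeff m k * fourierCoeff f 0 := by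
  have hr : r ≠ ∞ := (h2.trans_lt ENNReal.ofNat_lt_top).ne
  obtain ⟨P, hP⟩ := exists_rieszProj h1 h2
  have hPf : ∀ g ∈ hardy r, P g = g := fun g hg =>
    eq_of_mem_hardy (f := g) (hP g).1 (hP g).2 hg (by simp)
  have hP0 : ∀ g ∈ conjHardyZero r, P g = 0 := fun g hg =>
    eq_of_mem_hardy (f := g) (hP g).1 (hP g).2 (zero_mem _) (by simpa using hg)
  -- Composing with `P` turns an identity on `H^r` into one between operators on all of `L^r`, which
  -- can be checked on every monomial; density of the analytic monomials in `H^r` is not needed.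
  have key : coeffL r k ∘L (mulL m : L r →L[ℂ] L r) ∘L P =
      fourierCoeff m k • (coeffL r 0 ∘L P) := by
    refine eqOn_of_fourierLp hr fun j => ?_
    change fourierCoeff (m • P (fourierLp r j) : L r) k =
      fourierCoeff m k * fourierCoeff (P (fourierLp r j)) 0
    rcases lt_trichotomy j 0 with hj | rfl | hj
    · rw [hP0 _ (fourierLp_mem_conjHardyZero hj), Lp.smul_zero, coeff_zero, coeff_zero, mul_zero]
    · rw [hPf _ (fourierLp_mem_hardy le_rfl), fourierCoeff_smul_fourierLp, fourierCoeff_fourierLp,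
        sub_zero, if_pos rfl, mul_one]
    · rw [hPf _ (fourierLp_mem_hardy hj.le), fourierCoeff_smul_fourierLp, fourierCoeff_fourierLp,
        hm _ (by omega), if_neg (by omega), mul_zero]
  have := DFunLike.congr_fun key f
  change fourierCoeff (m • P f : L r) k = fourierCoeff m k * fourierCoeff (P f) 0 at this
  rwa [hPf f hf] at this

theorem smul_mem_hardy (h1 : 1 < r) (h2 : r ≤ 2) {m : L ∞} (hm : m ∈ hardy ∞)
    {f : L r} (hf : f ∈ hardy r) : (m • f : L r) ∈ hardy r := fun k hk => by
  rw [fourierCoeff_smul_of_mem_hardy h1 h2 hm hf hk.le, hm k hk, zero_mul]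

theorem star_smul_mem_conjHardyZero (h1 : 1 < r) (h2 : r ≤ 2) {m : L ∞} (hm : m ∈ hardy ∞)
    {f : L r} (hf : f ∈ conjHardyZero r) : (star m • f : L r) ∈ conjHardyZero r := by
  refine ⟨?_, ?_⟩
  · rw [star_lpSMul]
    exact smul_mem_hardy h1 h2 hm hf.1
  · rw [star_lpSMul, fourierCoeff_smul_of_mem_hardy h1 h2 hm hf.1 le_rfl, hf.2, mul_zero]

end Multiplication

/-! ### Columns, and multiplication by an inner matrix. -/

section Columns

variable {n : ℕ}

theorem isClosed_hardyVec (r : ℝ≥0∞) [Fact (1 ≤ r)] (n : ℕ) :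
    IsClosed (hardyVec r n : Set (LVec n r)) := by
  have : (hardyVec r n : Set (LVec n r)) = ⋂ i, {f | f i ∈ hardy r} := by
    ext f
    simp only [Set.mem_iInter]
    rfl
  rw [this]
  exact isClosed_iInter fun i => (isClosed_hardy r).preimage (PiLp.continuous_apply r _ i)

instance (r : ℝ≥0∞) [Fact (1 ≤ r)] (n : ℕ) : CompleteSpace (hardyVec r n) :=
  (isClosed_hardyVec r n).completeSpace_coe

/-- Multiplication by a matrix, as a bounded operator `(L^r)^n → (L^s)^n`. -/
noncomputable def matMulL {p r s : ℝ≥0∞} [ENNReal.HolderTriple p r s] [Fact (1 ≤ r)] [Fact (1 ≤ s)]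
    (M : LMat n p) : LVec n r →L[ℂ] LVec n s where
  toLinearMap := matMul M
  cont := (PiLp.continuous_toLp s _).comp <| continuous_pi fun i => continuous_finsetSum _ fun j _ =>
    (mulL (M i j) : L r →L[ℂ] L s).continuous.comp (PiLp.continuous_apply r _ j)

theorem matMul_apply {p r s : ℝ≥0∞} [ENNReal.HolderTriple p r s] [Fact (1 ≤ r)] [Fact (1 ≤ s)]
    (M : LMat n p) (f : LVec n r) (i : Fin n) :
    (matMul M f : LVec n s) i = ∑ j, (M i j • f j : L s) := rfl

theorem coeFn_matMul {p r s : ℝ≥0∞} [ENNReal.HolderTriple p r s] [Fact (1 ≤ r)] [Fact (1 ≤ s)]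
    (M : LMat n p) (f : LVec n r) :
    ∀ᵐ z ∂leb, (fun i => (matMul M f : LVec n s) i z) =
      (Matrix.of fun i j => M i j z) *ᵥ (fun j => f j z) := by
  have h1 : ∀ᵐ z ∂leb, ∀ i j, (M i j • f j : L s) z = M i j z * f j z :=
    ae_all_iff.2 fun i => ae_all_iff.2 fun j => Lp.coeFn_lpSMul (M i j) (f j)
  have h2 : ∀ᵐ z ∂leb, ∀ i, (matMul M f : LVec n s) i z = ∑ j, (M i j • f j : L s) z := by
    refine ae_all_iff.2 fun i => ?_
    rw [matMul_apply]
    filter_upwards [Lp.coeFn_finsetSum Finset.univ fun j => (M i j • f j : L s)] with z hz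
    simpa using hz
  filter_upwards [h1, h2] with z h1 h2
  ext i
  simp only [h2, h1, Matrix.mulVec, dotProduct, Matrix.of_apply]

theorem coeFn_conjTranspose (M : LMat n ∞) :
    ∀ᵐ z ∂leb, (Matrix.of fun i j => Mᴴ i j z) = (Matrix.of fun i j => M i j z)ᴴ := by
  have : ∀ᵐ z ∂leb, ∀ i j, (star (M i j) : L ∞) z = star (M i j z) :=
    ae_all_iff.2 fun i => ae_all_iff.2 fun j => Lp.coeFn_star (M i j)
  filter_upwards [this] with z hz
  ext i j
  exact hz j i

theorem LVec.ext_ae {r : ℝ≥0∞} {f g : LVec n r}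
    (h : ∀ᵐ z ∂leb, (fun i => f i z) = fun i => g i z) : f = g := by
  ext1 i
  exact Lp.ext (h.mono fun z hz => congrFun hz i)

variable {r : ℝ≥0∞} [Fact (1 ≤ r)] {Θ : LMat n ∞}

theorem IsInner.conjTranspose_matMul (hΘ : IsInner Θ) (f : LVec n r) :
    (matMul Θᴴ (matMul Θ f : LVec n r) : LVec n r) = f := by
  refine LVec.ext_ae ?_
  filter_upwards [coeFn_matMul (s := r) Θᴴ (matMul Θ f : LVec n r), coeFn_matMul (s := r) Θ f,
    coeFn_conjTranspose Θ, hΘ.unitary] with z h1 h2 h3 h4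
  rw [h1, h2, h3, Matrix.mulVec_mulVec, ← Matrix.star_eq_conjTranspose,
    Matrix.mem_unitaryGroup_iff'.1 h4, Matrix.one_mulVec]

theorem IsInner.matMul_conjTranspose (hΘ : IsInner Θ) (f : LVec n r) :
    (matMul Θ (matMul Θᴴ f : LVec n r) : LVec n r) = f := by
  refine LVec.ext_ae ?_
  filter_upwards [coeFn_matMul (s := r) Θ (matMul Θᴴ f : LVec n r), coeFn_matMul (s := r) Θᴴ f,
    coeFn_conjTranspose Θ, hΘ.unitary] with z h1 h2 h3 h4
  rw [h1, h2, h3, Matrix.mulVec_mulVec, ← Matrix.star_eq_conjTranspose,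
    Matrix.mem_unitaryGroup_iff.1 h4, Matrix.one_mulVec]

theorem IsInner.matMul_mem (hΘ : IsInner Θ) (h1 : 1 < r) (h2 : r ≤ 2) {f : LVec n r}
    (hf : f ∈ hardyVec r n) : (matMul Θ f : LVec n r) ∈ hardyVec r n := fun i =>
  sum_mem fun j _ => smul_mem_hardy h1 h2 (hΘ.mem_hardy i j) (hf j)

theorem IsInner.conjTranspose_matMul_mem (hΘ : IsInner Θ) (h1 : 1 < r) (h2 : r ≤ 2)
    {f : LVec n r} (hf : f ∈ conjHardyZeroVec r n) :
    (matMul Θᴴ f : LVec n r) ∈ conjHardyZeroVec r n := fun i =>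
  sum_mem fun j _ => star_smul_mem_conjHardyZero h1 h2 (hΘ.mem_hardy j i) (hf j)

theorem IsInner.mem_modelSpace_iff (hΘ : IsInner Θ) {k : LVec n r} :
    k ∈ modelSpace Θ r ↔ k ∈ hardyVec r n ∧ (matMul Θᴴ k : LVec n r) ∈ conjHardyZeroVec r n := by
  constructor
  · rintro ⟨⟨c, hc, rfl⟩, hk⟩
    refine ⟨hk, ?_⟩
    rwa [hΘ.conjTranspose_matMul]
  · rintro ⟨hk, hc⟩
    exact ⟨⟨_, hc, hΘ.matMul_conjTranspose k⟩, hk⟩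

/-- The Riesz projection of columns is bounded. -/
theorem exists_rieszProjVec (n : ℕ) (h1 : 1 < r) (h2 : r ≤ 2) :
    ∃ P : LVec n r →L[ℂ] LVec n r, ∀ f, IsRieszProj f (P f) := by
  obtain ⟨P, hP⟩ := exists_rieszProj h1 h2
  refine ⟨{ toFun := fun f => WithLp.toLp r fun i => P (f i)
            map_add' := fun f g => by ext1 i; simp
            map_smul' := fun c f => by ext1 i; simp
            cont := (PiLp.continuous_toLp r _).comp <| continuous_pi fun i =>
              P.continuous.comp (PiLp.continuous_apply r _ i) },
    fun f => ⟨fun i => (hP (f i)).1, fun i => (hP (f i)).2⟩⟩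

end Columns

/-! ### The projection onto the model space. -/

section Projections

variable {n : ℕ} {r : ℝ≥0∞} [Fact (1 ≤ r)] {Θ : LMat n ∞} {f g g' u : LVec n r}

theorem IsRieszProj.unique (h : IsRieszProj f g) (h' : IsRieszProj f g') : g = g' := by
  ext1 i
  exact eq_of_mem_hardy (h.1 i) (h.2 i) (h'.1 i) (h'.2 i)

theorem isRieszProj_self (hf : f ∈ hardyVec r n) : IsRieszProj f f :=
  ⟨hf, by rw [sub_self]; exact zero_mem _⟩

theorem isRieszProj_zero (hf : f ∈ conjHardyZeroVec r n) : IsRieszProj f 0 :=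
  ⟨zero_mem _, by rwa [sub_zero]⟩

theorem IsRieszProj.add {f' : LVec n r} (h : IsRieszProj f g) (h' : IsRieszProj f' g') :
    IsRieszProj (f + f') (g + g') :=
  ⟨add_mem h.1 h'.1, by rw [add_sub_add_comm]; exact add_mem h.2 h'.2⟩

theorem IsModelProj.unique (h : IsModelProj Θ f g) (h' : IsModelProj Θ f g') : g = g' := by
  obtain ⟨u, hu, hg⟩ := h
  obtain ⟨u', hu', hg'⟩ := h'
  obtain rfl := hu.unique hu'
  exact hg.unique hg'

/-- `Θ^* g` is `P_{r-}(Θ^* f)` minus `Θ^*` of a column in the conjugate space, and `Θ^*` preserves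
that space. -/
theorem IsModelProj.mem_modelSpace (hΘ : IsInner Θ) (h1 : 1 < r) (h2 : r ≤ 2)
    (h : IsModelProj Θ f g) : g ∈ modelSpace Θ r := by
  obtain ⟨u, hu, hg⟩ := h
  refine hΘ.mem_modelSpace_iff.2 ⟨hg.1, ?_⟩
  have h3 := hΘ.conjTranspose_matMul_mem h1 h2 hg.2
  rw [map_sub, hΘ.conjTranspose_matMul] at h3
  convert sub_mem hu.2 h3 using 1
  abel

/-- `P_{Θ,r}` annihilates `f - y`, since `Θ^*` keeps it in the conjugate space. This allows `G f` to
be replaced by its Riesz projection. -/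
theorem IsModelProj.of_isRieszProj (hΘ : IsInner Θ) (h1 : 1 < r) (h2 : r ≤ 2) {y : LVec n r}
    (h : IsModelProj Θ f g) (hy : IsRieszProj f y) : IsModelProj Θ y g := by
  obtain ⟨u, hu, hg⟩ := h
  have h3 := hΘ.conjTranspose_matMul_mem h1 h2 hy.2
  rw [map_sub] at h3
  refine ⟨u, ⟨hu.1, ?_⟩, hg.1, ?_⟩
  · convert sub_mem hu.2 h3 using 1
    abel
  · have h4 := hg.2
    rw [map_sub, hΘ.matMul_conjTranspose] at h4 ⊢
    convert sub_mem h4 hy.2 using 1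
    abel

theorem isModelProj_of_mem_hardyVec (hΘ : IsInner Θ) (h1 : 1 < r) (h2 : r ≤ 2)
    (hf : f ∈ hardyVec r n) (hu : IsRieszProj (matMul Θᴴ f) u) :
    IsModelProj Θ f (f - matMul Θ u) := by
  refine ⟨u, hu, ?_⟩
  rw [map_sub, hΘ.matMul_conjTranspose]
  exact isRieszProj_self (sub_mem hf (hΘ.matMul_mem h1 h2 hu.1))

theorem isModelProj_matMul (hΘ : IsInner Θ) (hf : f ∈ hardyVec r n) :
    IsModelProj Θ (matMul Θ f : LVec n r) 0 := by
  refine ⟨f, ?_, ?_⟩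
  · rw [hΘ.conjTranspose_matMul]
    exact isRieszProj_self hf
  · rw [hΘ.conjTranspose_matMul, sub_self, map_zero]
    exact isRieszProj_self (zero_mem _)

theorem isModelProj_self (hΘ : IsInner Θ) (hf : f ∈ modelSpace Θ r) : IsModelProj Θ f f := by
  refine ⟨0, isRieszProj_zero (hΘ.mem_modelSpace_iff.1 hf).2, ?_⟩
  rw [sub_zero, hΘ.matMul_conjTranspose]
  exact isRieszProj_self hf.2

/-- The Riesz projection `P`, the projection `Q` onto the model space, the inclusion `ι` of the model
space in `(H^r)^n` and the multiplication `m` by `Θ` are bounded, and `ι`, `m` decompose `(H^r)^n`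
into the model space and a copy of itself. -/
theorem exists_projections (hΘ : IsInner Θ) (h1 : 1 < r) (h2 : r ≤ 2) :
    ∃ (P : LVec n r →L[ℂ] hardyVec r n) (Q : LVec n r →L[ℂ] modelSpace Θ r)
      (ι : modelSpace Θ r →L[ℂ] hardyVec r n) (m : hardyVec r n →L[ℂ] hardyVec r n),
      (∀ f, IsRieszProj f (P f)) ∧ (∀ f, IsModelProj Θ f (Q f)) ∧
      (∀ k, (ι k : LVec n r) = k) ∧ (∀ h, (m h : LVec n r) = matMul Θ (h : LVec n r)) ∧
      (∀ x : hardyVec r n, ι (Q x) + m (P (matMul Θᴴ (x : LVec n r))) = x) ∧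
      (∀ x, Q (m x) = 0) ∧ (∀ k, Q (ι k) = k) ∧
      (∀ k, P (matMul Θᴴ (ι k : LVec n r)) = 0) ∧
      ∀ x, P (matMul Θᴴ (m x : LVec n r)) = x := by
  obtain ⟨P, hP⟩ := exists_rieszProjVec n h1 h2
  let Q : LVec n r →L[ℂ] LVec n r :=
    P ∘L (matMulL Θ : LVec n r →L[ℂ] LVec n r) ∘L (ContinuousLinearMap.id ℂ _ - P) ∘L
      (matMulL Θᴴ : LVec n r →L[ℂ] LVec n r)
  have hQ : ∀ f, IsModelProj Θ f (Q f) := fun f => ⟨P (matMul Θᴴ f), hP _, hP _⟩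
  refine ⟨P.codRestrict _ fun f => (hP f).1,
    Q.codRestrict _ fun f => (hQ f).mem_modelSpace hΘ h1 h2,
    (modelSpace Θ r).subtypeL.codRestrict _ fun k => k.2.2,
    ((matMulL Θ : LVec n r →L[ℂ] LVec n r) ∘L (hardyVec r n).subtypeL).codRestrict _
      fun h => hΘ.matMul_mem h1 h2 h.2,
    hP, hQ, fun _ => rfl, fun _ => rfl, fun x => Subtype.ext ?_, fun x => Subtype.ext ?_,
    fun k => Subtype.ext ?_, fun k => Subtype.ext ?_, fun x => Subtype.ext ?_⟩
  · have h := (hQ x).unique (isModelProj_of_mem_hardyVec hΘ h1 h2 x.2 (hP _))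
    change Q (x : LVec n r) + (matMul Θ (P (matMul Θᴴ (x : LVec n r) : LVec n r)) : LVec n r) =
      (x : LVec n r)
    rw [h, sub_add_cancel]
  · exact (hQ _).unique (isModelProj_matMul hΘ x.2)
  · exact (hQ _).unique (isModelProj_self hΘ k.2)
  · exact (hP _).unique (isRieszProj_zero (hΘ.mem_modelSpace_iff.1 k.2).2)
  · refine (hP _).unique ?_
    change IsRieszProj (matMul Θᴴ (matMul Θ (x : LVec n r) : LVec n r)) (x : LVec n r)
    rw [hΘ.conjTranspose_matMul]
    exact isRieszProj_self x.2

end Projections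

/-! ### Equivalence after extension from two decompositions. -/

section Equivalence

/-- Let `H₁ = K₁ ⊕ H₁` through `ι₁`, `m₁` with left inverses `π₁`, `a₁`, and likewise
`H₂ = K₂ ⊕ H₂`. Then `(f₁, f₂) ↦ (a₁ f₁, B f₁ + m₂ f₂)` is equivalent after extension to
`π₂ B ι₁`. -/
theorem equivAfterExt_of_decomposition {H₁ H₂ K₁ K₂ : Type}
    [NormedAddCommGroup H₁] [NormedSpace ℂ H₁] [CompleteSpace H₁]
    [NormedAddCommGroup H₂] [NormedSpace ℂ H₂] [CompleteSpace H₂]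
    [NormedAddCommGroup K₁] [NormedSpace ℂ K₁] [NormedAddCommGroup K₂] [NormedSpace ℂ K₂]
    {π₁ : H₁ →L[ℂ] K₁} {ι₁ : K₁ →L[ℂ] H₁} {a₁ m₁ : H₁ →L[ℂ] H₁}
    {π₂ : H₂ →L[ℂ] K₂} {ι₂ : K₂ →L[ℂ] H₂} {a₂ m₂ : H₂ →L[ℂ] H₂}
    (s₁ : ∀ x, ι₁ (π₁ x) + m₁ (a₁ x) = x) (πm₁ : ∀ x, π₁ (m₁ x) = 0) (πι₁ : ∀ k, π₁ (ι₁ k) = k)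
    (aι₁ : ∀ k, a₁ (ι₁ k) = 0) (am₁ : ∀ x, a₁ (m₁ x) = x)
    (s₂ : ∀ x, ι₂ (π₂ x) + m₂ (a₂ x) = x) (πm₂ : ∀ x, π₂ (m₂ x) = 0) (πι₂ : ∀ k, π₂ (ι₂ k) = k)
    (aι₂ : ∀ k, a₂ (ι₂ k) = 0) (am₂ : ∀ x, a₂ (m₂ x) = x)
    (B : H₁ →L[ℂ] H₂) (T : (H₁ × H₂) →L[ℂ] (H₁ × H₂)) (A : K₁ →L[ℂ] K₂)
    (hT : ∀ f₁ f₂, T (f₁, f₂) = (a₁ f₁, B f₁ + m₂ f₂)) (hA : ∀ k, A k = π₂ (B (ι₁ k))) :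
    EquivAfterExt T A := by
  -- The extension of `T` is by the zero space `Fin 0 → ℂ`, that of `A` by `H₁ × H₂`. `F` splits
  -- `f₁` and adds to `f₂` the `m₂`-coordinate of `B f₁`. `E` reassembles the second target factor
  -- and restores `ι₂ π₂ B m₁`, the part of `B f₁` that neither `A` nor the shift of `f₂` accounts
  -- for.
  let F : ((H₁ × H₂) × (Fin 0 → ℂ)) →L[ℂ] (K₁ × (H₁ × H₂)) :=
    (π₁.prod (a₁.prod (a₂ ∘L B)) ∘L .fst ℂ H₁ H₂ +
      (0 : (H₁ × H₂) →L[ℂ] K₁).prod ((0 : (H₁ × H₂) →L[ℂ] H₁).prod (.snd ℂ H₁ H₂))) ∘L .fst ℂ _ _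
  let F' : (K₁ × (H₁ × H₂)) →L[ℂ] ((H₁ × H₂) × (Fin 0 → ℂ)) :=
    let c : (K₁ × (H₁ × H₂)) →L[ℂ] H₁ :=
      ι₁ ∘L .fst ℂ _ _ + m₁ ∘L .fst ℂ _ _ ∘L .snd ℂ _ _
    (c.prod (.snd ℂ _ _ ∘L .snd ℂ _ _ - a₂ ∘L B ∘L c)).prod 0
  let E : (K₂ × (H₁ × H₂)) →L[ℂ] ((H₁ × H₂) × (Fin 0 → ℂ)) :=
    ((.fst ℂ _ _ ∘L .snd ℂ _ _ : (K₂ × (H₁ × H₂)) →L[ℂ] H₁).prod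
      (ι₂ ∘L .fst ℂ _ _ + (ι₂ ∘L π₂ ∘L B ∘L m₁) ∘L .fst ℂ _ _ ∘L .snd ℂ _ _ +
        m₂ ∘L .snd ℂ _ _ ∘L .snd ℂ _ _)).prod 0
  let E' : ((H₁ × H₂) × (Fin 0 → ℂ)) →L[ℂ] (K₂ × (H₁ × H₂)) :=
    ((π₂ ∘L .snd ℂ _ _ - (π₂ ∘L B ∘L m₁) ∘L .fst ℂ _ _).prod
      ((ContinuousLinearMap.fst ℂ H₁ H₂).prod (a₂ ∘L .snd ℂ _ _))) ∘L .fst ℂ _ _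
  have hF : ∀ f₁ f₂ e, F ((f₁, f₂), e) = (π₁ f₁, a₁ f₁, a₂ (B f₁) + f₂) := fun f₁ f₂ e => by
    simp [F]
  have hF' : ∀ k h w, F' (k, h, w) =
      ((ι₁ k + m₁ h, w - a₂ (B (ι₁ k + m₁ h))), 0) := fun k h w => rfl
  have hE : ∀ k h w, E (k, h, w) = ((h, ι₂ k + ι₂ (π₂ (B (m₁ h))) + m₂ w), 0) :=
    fun k h w => rfl
  have hE' : ∀ h y e, E' ((h, y), e) = (π₂ y - π₂ (B (m₁ h)), h, a₂ y) := fun h y e => rfl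
  refine ⟨Fin 0 → ℂ, inferInstance, inferInstance, inferInstance, H₁ × H₂, inferInstance,
    inferInstance, inferInstance, ContinuousLinearEquiv.equivOfInverse E E' ?_ ?_,
    ContinuousLinearEquiv.equivOfInverse F F' ?_ ?_, ?_⟩
  · rintro ⟨k, h, w⟩
    simp [hE, hE', πι₂, πm₂, aι₂, am₂]
  · rintro ⟨⟨h, y⟩, e⟩
    have : ι₂ (π₂ y - π₂ (B (m₁ h))) + ι₂ (π₂ (B (m₁ h))) + m₂ (a₂ y) = y := by
      rw [map_sub, sub_add_cancel, s₂]
    rw [hE', hE, this, Subsingleton.elim e 0]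
  · rintro ⟨⟨f₁, f₂⟩, e⟩
    rw [hF, hF', s₁, add_sub_cancel_left, Subsingleton.elim e 0]
  · rintro ⟨k, h, w⟩
    rw [hF', hF, add_sub_cancel]
    simp [πι₁, πm₁, aι₁, am₁]
  · refine ContinuousLinearMap.ext ?_
    rintro ⟨⟨f₁, f₂⟩, e⟩
    change (T (f₁, f₂), e) = E (A.prodMap (ContinuousLinearMap.id ℂ _) (F ((f₁, f₂), e)))
    have h : ι₂ (π₂ (B (ι₁ (π₁ f₁)))) + ι₂ (π₂ (B (m₁ (a₁ f₁)))) + m₂ (a₂ (B f₁) + f₂) =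
        B f₁ + m₂ f₂ := by
      rw [← map_add ι₂, ← map_add π₂, ← map_add B, s₁, map_add m₂, ← add_assoc, s₂]
    rw [hF]
    change _ = E (A (π₁ f₁), a₁ f₁, a₂ (B f₁) + f₂)
    rw [hE, hT, hA, h, Subsingleton.elim e 0]

end Equivalence

end MTTO

theorem mainTheorem4 (n : ℕ) (p q : ℝ≥0∞) [Fact (1 ≤ q)] [ENNReal.HolderTriple p 2 q] (hp : 2 < p)
    (Θ : MTTO.LMat n ∞) (hΘ : MTTO.IsInner Θ) (G : MTTO.LMat n p) :
    (∃! T : (MTTO.hardyVec 2 n × MTTO.hardyVec q n) →L[ℂ]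
        (MTTO.hardyVec 2 n × MTTO.hardyVec q n), MTTO.IsBlockToeplitz Θ G T) ∧
    (∃! A : MTTO.modelSpace Θ 2 →L[ℂ] MTTO.modelSpace Θ q, MTTO.IsModifiedMTTO Θ G A) ∧
    ∀ (T : (MTTO.hardyVec 2 n × MTTO.hardyVec q n) →L[ℂ]
        (MTTO.hardyVec 2 n × MTTO.hardyVec q n))
      (A : MTTO.modelSpace Θ 2 →L[ℂ] MTTO.modelSpace Θ q),
      MTTO.IsBlockToeplitz Θ G T → MTTO.IsModifiedMTTO Θ G A → MTTO.EquivAfterExt T A := by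
  open MTTO in
  have hinv : p⁻¹ + 2⁻¹ = q⁻¹ := ENNReal.HolderTriple.inv_add_inv_eq_inv p 2 q
  have hq2 : q ≤ 2 := by
    rw [← ENNReal.inv_le_inv, ← hinv]
    exact le_add_self
  have hq1 : 1 < q := by
    rw [← ENNReal.inv_lt_inv, ← hinv, inv_one, ← ENNReal.inv_two_add_inv_two]
    exact ENNReal.add_lt_add_right (by simp) (ENNReal.inv_lt_inv.2 hp)
  obtain ⟨P₁, Q₁, ι₁, m₁, hP₁, hQ₁, hι₁, hm₁, s₁, πm₁, πι₁, aι₁, am₁⟩ :=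
    exists_projections (r := 2) hΘ (by norm_num) le_rfl
  obtain ⟨P₂, Q₂, ι₂, m₂, hP₂, hQ₂, hι₂, hm₂, s₂, πm₂, πι₂, aι₂, am₂⟩ :=
    exists_projections hΘ hq1 hq2
  let a₁ : hardyVec 2 n →L[ℂ] hardyVec 2 n := P₁ ∘L matMulL Θᴴ ∘L (hardyVec 2 n).subtypeL
  let a₂ : hardyVec q n →L[ℂ] hardyVec q n := P₂ ∘L matMulL Θᴴ ∘L (hardyVec q n).subtypeL
  let B : hardyVec 2 n →L[ℂ] hardyVec q n := P₂ ∘L matMulL G ∘L (hardyVec 2 n).subtypeL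
  have hB : ∀ f : hardyVec 2 n, IsRieszProj (matMul G (f : LVec n 2)) (B f : LVec n q) :=
    fun f => hP₂ _
  -- Uniqueness of Riesz projections turns the defining relation into a formula, giving existence
  -- and uniqueness of `T`; likewise for `A` below.
  have hT : ∀ T, IsBlockToeplitz Θ G T ↔ ∀ f₁ f₂, T (f₁, f₂) = (a₁ f₁, B f₁ + m₂ f₂) := by
    have key : ∀ (f₁ : hardyVec 2 n) (f₂ : hardyVec q n),
        IsRieszProj (matMul Θᴴ (f₁ : LVec n 2)) (a₁ f₁ : LVec n 2) ∧
        IsRieszProj (matMul G (f₁ : LVec n 2) + matMul Θ (f₂ : LVec n q))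
          ((B f₁ + m₂ f₂ : hardyVec q n) : LVec n q) := fun f₁ f₂ =>
      ⟨hP₁ _, (hB f₁).add (by rw [← hm₂]; exact isRieszProj_self (m₂ f₂).2)⟩
    refine fun T => ⟨fun h f₁ f₂ => Prod.ext ?_ ?_, fun h f₁ f₂ => ?_⟩
    · exact Subtype.ext ((h f₁ f₂).1.unique (key f₁ f₂).1)
    · exact Subtype.ext ((h f₁ f₂).2.unique (key f₁ f₂).2)
    · rw [h]
      exact key f₁ f₂
  have hA : ∀ A, IsModifiedMTTO Θ G A ↔ ∀ k, A k = Q₂ (B (ι₁ k)) := by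
    have key : ∀ k : modelSpace Θ 2, IsModelProj Θ (matMul G (k : LVec n 2) : LVec n q)
        (Q₂ (B (ι₁ k))) := fun k => by
      have h1 := hQ₂ (matMul G (k : LVec n 2))
      have h2 := hB (ι₁ k)
      rw [hι₁] at h2
      rwa [← (h1.of_isRieszProj hΘ hq1 hq2 h2).unique (hQ₂ _)]
    exact fun A => ⟨fun h k => Subtype.ext ((h k).unique (key k)), fun h k => by
      rw [h]; exact key k⟩
  refine ⟨⟨(a₁.prod B) ∘L .fst ℂ _ _ + (0 : _ →L[ℂ] hardyVec 2 n).prod (m₂ ∘L .snd ℂ _ _),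
      (hT _).2 fun f₁ f₂ => by simp, fun T h => ?_⟩,
    ⟨Q₂ ∘L (hardyVec q n).subtypeL ∘L B ∘L ι₁, (hA _).2 fun k => rfl, fun A h => ?_⟩,
    fun T A h h' => ?_⟩
  · refine ContinuousLinearMap.ext ?_
    rintro ⟨f₁, f₂⟩
    rw [(hT T).1 h]
    simp
  · ext1 k
    exact (hA A).1 h k
  exact equivAfterExt_of_decomposition (π₁ := Q₁ ∘L (hardyVec 2 n).subtypeL) (ι₁ := ι₁)
    (a₁ := a₁) (m₁ := m₁) (π₂ := Q₂ ∘L (hardyVec q n).subtypeL) (ι₂ := ι₂) (a₂ := a₂) (m₂ := m₂)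
    s₁ πm₁ πι₁ aι₁ am₁ s₂ πm₂ πι₂ aι₂ am₂ B T A ((hT T).1 h) ((hA A).1 h')
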